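/- All graphs are finite and simple. A graph is outerplanar if it can be embedded in the plane so that all its vertices lie on the boundary of one face; equivalently, if it has neither $K_4$ nor $K_{2,3}$ as a minor. A dominating set of a graph $G$ is a set $S\subseteq V(G)$ such that every vertex of $V(G)\setminus S$ has a neighbour in $S$. For $S\subseteq V(G)$, let $B_S(G)$ be the set of vertices $v\notin S$ with $\deg_G(v)\ge 4$, and let $D_S(G)$ be the set of vertices $v\notin S$ such that $\deg_G(v)\le 3$ and every neighbour of $v$ has degree at most $3$ in $G$. Then for every outerplanar graph $G$ and every dominating set $S$ of $G$, $$|S|\;\ge\;\tfrac14\bigl(|B_S(G)|+|D_S(G)|\bigr).$$ -/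

import Mathlib

namespace OuterplanarDomination

/-- `H` is a minor of `G`: there are pairwise disjoint vertex sets `X h` (branch sets), one for
each vertex `h` of `H`, each inducing a connected (in particular non-empty) subgraph of `G`, such
that for every edge `h h'` of `H` there is an edge of `G` between `X h` and `X h'`. Equivalently,
`H` arises from `G` by deleting vertices and edges and contracting edges. -/
def IsMinor {W V : Type*} (H : SimpleGraph W) (G : SimpleGraph V) : Prop :=
  ∃ X : W → Set V,
    (∀ h, (G.induce (X h)).Connected) ∧
    (∀ h h', h ≠ h' → Disjoint (X h) (X h')) ∧
    ∀ h h', H.Adj h h' → ∃ x ∈ X h, ∃ y ∈ X h', G.Adj x y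

/-- A graph is outerplanar if it has neither `K₄` nor `K_{2,3}` as a minor. (Planarity is implied:
`K₄` is a minor of `K₅` and `K_{2,3}` is a minor of `K_{3,3}`.) -/
def IsOuterplanar {V : Type*} (G : SimpleGraph V) : Prop :=
  ¬ IsMinor (SimpleGraph.completeGraph (Fin 4)) G ∧
    ¬ IsMinor (completeBipartiteGraph (Fin 2) (Fin 3)) G

/-- Every vertex outside `S` has a neighbour in `S`. -/
def IsDominatingSet {V : Type*} (G : SimpleGraph V) (S : Finset V) : Prop :=
  ∀ v, v ∉ S → ∃ s ∈ S, G.Adj v s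

section

variable {V : Type*} [Fintype V] [DecidableEq V]

/-- `V_{4⁺}(G)`: the vertices of degree at least four. -/
def highDegree (G : SimpleGraph V) [DecidableRel G.Adj] : Finset V :=
  {v | 4 ≤ G.degree v}

/-- `V*(G)`: the vertices of degree at most three all of whose neighbours have degree at most
three. -/
def lowDegree (G : SimpleGraph V) [DecidableRel G.Adj] : Finset V :=
  {v | G.degree v ≤ 3 ∧ ∀ w, G.Adj v w → G.degree w ≤ 3}

/-- `B_S(G) = V_{4⁺}(G) \ S`. -/
def setB (G : SimpleGraph V) [DecidableRel G.Adj] (S : Finset V) : Finset V :=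
  highDegree G \ S

/-- `D_S(G) = V*(G) \ S`. -/
def setD (G : SimpleGraph V) [DecidableRel G.Adj] (S : Finset V) : Finset V :=
  lowDegree G \ S

end

end OuterplanarDomination

/-! The bound holds for every graph without a `K_{2,3}` minor. Call a vertex of `S` low if it has a
neighbour in `D_S(G)`, and high otherwise. A low vertex has degree at most `3`, and `D_S(G)` is
dominated by the low vertices only. Assign every vertex outside `S` to a neighbour in `S`, a high one
if possible. Each high vertex `r` is the centre of a block: `r` and the vertices outside
`S ∪ D_S(G)` assigned to `r`. What is left outside `D_S(G)` (`remainder`) contains the low vertices;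
its components are called cells, and each of them contains a low vertex.

A vertex `b ∈ B_S(G)` in the block of `r` is linked if it reaches another block by a path avoiding
its own. The linked vertices number at most `4` times the high vertices
(`IsStarFamily.sum_card_le`): merge the blocks two at a time, contracting a path between them. Only
the vertices of one block that reach the other through this path have to be given up, and there are
at most two in each block, as three of them would form a `K_{2,3}` with the centre of their block
and the contraction of the path and the other block.

All the rest of `B_S(G) ∪ D_S(G)` amounts to at most `4` times the low vertices
(`IsAssignment.card_cell_le`). As `b ∈ B_S(G)` has degree at least `4` and at most two common
neighbours with the centre of its block, an unlinked `b` is adjacent to a cell, which then has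
neighbours in no other block; by `K_{2,3}`-freeness at most two unlinked vertices are adjacent to
the same cell. The other vertices to be counted are neighbours of low vertices, at most
three for each. So a cell with `k` low vertices accounts for at most `3 * k + 2` vertices, which is
enough for `k ≥ 2`. For `k = 1` the value `5` is excluded by `IsAssignment.false_of_neighbors`. -/

namespace OuterplanarDomination

/-! ### Connected vertex sets and `K_{2,3}` minors -/

section Connectivity

variable {V : Type*} {G : SimpleGraph V}

lemma connected_singleton (v : V) : (G.induce {v}).Connected := by
  rw [SimpleGraph.connected_iff_exists_forall_reachable]
  exact ⟨⟨v, rfl⟩, fun ⟨w, hw⟩ => by obtain rfl : w = v := hw; exact .refl _⟩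

lemma connected_insert {A : Set V} {p v : V} (hA : (G.induce A).Connected) (hv : v ∈ A)
    (hpv : G.Adj p v) : (G.induce (insert p A)).Connected := by
  rw [Set.insert_eq]
  exact SimpleGraph.connected_induce_union (connected_singleton p).preconnected hA.preconnected
    rfl hv hpv

/-- A set is connected as soon as each of its points lies with a fixed base point in a connected
subset. -/
lemma connected_of_patches {A : Set V} (u : V) (hu : u ∈ A)
    (h : ∀ v ∈ A, ∃ B ⊆ A, (G.induce B).Connected ∧ u ∈ B ∧ v ∈ B) : (G.induce A).Connected := by
  refine SimpleGraph.induce_connected_of_patches u hu fun {v} hv => ?_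
  obtain ⟨B, hBA, hB, huB, hvB⟩ := h v hv
  exact ⟨B, hBA, huB, hvB, hB.preconnected _ _⟩

lemma connected_union_of_adj {C T : Set V} (hC : (G.induce C).Connected)
    (hT : ∀ t ∈ T, ∃ c ∈ C, G.Adj t c) : (G.induce (C ∪ T)).Connected := by
  obtain ⟨⟨u, hu⟩⟩ := hC.nonempty
  refine connected_of_patches u (.inl hu) ?_
  rintro v (hv | hv)
  · exact ⟨C, Set.subset_union_left, hC, hu, hv⟩
  · obtain ⟨c, hc, hvc⟩ := hT v hv
    exact ⟨insert v C, Set.insert_subset (.inr hv) Set.subset_union_left,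
      connected_insert hC hc hvc, .inr hu, .inl rfl⟩

/-- `T` is the set of inner vertices of a path from `p` to `u ∈ U` of which no inner vertex is in
`U`. The path is recorded only through the connectedness of its segments; `T` may be empty. -/
structure IsConnector (G : SimpleGraph V) (U : Set V) (p u : V) (T : Set V) : Prop where
  mem : u ∈ U
  disjoint : Disjoint T U
  connected_end : (G.induce (insert u T)).Connected
  connected_start : (G.induce (insert p T)).Connected
  connected : (G.induce (insert p (insert u T))).Connected
  adj_start : ∃ x ∈ insert u T, G.Adj p x
  adj_end : ∃ y ∈ insert p T, G.Adj u y

lemma isConnector_empty {U : Set V} {p v : V} (hv : v ∈ U) (hpv : G.Adj p v) :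
    IsConnector G U p v ∅ := by
  have hsing (x : V) : (G.induce (insert x ∅)).Connected := by
    rw [insert_empty_eq]
    exact connected_singleton x
  exact ⟨hv, Set.empty_disjoint _, hsing v, hsing p, connected_insert (hsing v) (.inl rfl) hpv,
    ⟨v, .inl rfl, hpv⟩, p, .inl rfl, hpv.symm⟩

lemma exists_isConnector_of_walk {A U : Set V} {v w : A} (q : (G.induce A).Walk v w)
    (hw : (w : V) ∈ U) (p : V) (hpv : G.Adj p v) :
    ∃ T ⊆ A, ∃ u ∈ A, IsConnector G U p u T := by
  induction q generalizing p with
  | nil => exact ⟨∅, Set.empty_subset _, _, Subtype.prop _, isConnector_empty hw hpv⟩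
  | cons hadj q ih =>
    rename_i v v' w
    by_cases hvU : (v : V) ∈ U
    · exact ⟨∅, Set.empty_subset _, v, v.2, isConnector_empty hvU hpv⟩
    · obtain ⟨T, hTA, u, huA, h⟩ := ih hw v hadj
      have h1 : (G.induce (insert u (insert (v : V) T))).Connected := by
        rw [Set.insert_comm]
        exact h.connected
      obtain ⟨y, hy, huy⟩ := h.adj_end
      exact ⟨insert (v : V) T, Set.insert_subset v.2 hTA, u, huA, h.mem,
        Set.disjoint_insert_left.2 ⟨hvU, h.disjoint⟩, h1,
        connected_insert h.connected_start (.inl rfl) hpv,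
        connected_insert h1 (.inr (.inl rfl)) hpv, ⟨v, .inr (.inl rfl), hpv⟩, y, .inr hy, huy⟩

lemma exists_isConnector {A U : Set V} (hA : (G.induce A).Connected) (hAU : (A ∩ U).Nonempty)
    {p : V} (hp : ∃ v ∈ A, G.Adj p v) : ∃ T ⊆ A, ∃ u ∈ A, IsConnector G U p u T := by
  obtain ⟨w, hwA, hwU⟩ := hAU
  obtain ⟨v, hvA, hpv⟩ := hp
  obtain ⟨q⟩ := hA.preconnected ⟨v, hvA⟩ ⟨w, hwA⟩
  exact exists_isConnector_of_walk q hwU p hpv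

end Connectivity

section Bipartite

variable {V : Type*} {G : SimpleGraph V}

/-- In a graph without a `K_{2,3}` minor, at most two vertices outside two disjoint connected sets
have neighbours in both of them. -/
lemma card_le_two_of_not_isMinor (hG : ¬ IsMinor (completeBipartiteGraph (Fin 2) (Fin 3)) G)
    {C N : Set V} (hC : (G.induce C).Connected) (hN : (G.induce N).Connected)
    (hCN : Disjoint C N) (F : Finset V)
    (hF : ∀ b ∈ F, b ∉ C ∧ b ∉ N ∧ (∃ c ∈ C, G.Adj b c) ∧ ∃ n ∈ N, G.Adj b n) :
    F.card ≤ 2 := by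
  by_contra! hcard
  obtain ⟨T, hTF, hT⟩ := Finset.exists_subset_card_eq (show 3 ≤ F.card from hcard)
  let e : Fin 3 ≃ T := (Fintype.equivFinOfCardEq (by simpa using hT)).symm
  have he (k : Fin 3) := hF (e k) (hTF (e k).2)
  have hE : ∀ (a : Fin 2) (k : Fin 3), ∃ x ∈ (![C, N] a : Set V), G.Adj (e k) x := by
    intro a k
    fin_cases a
    · exact (he k).2.2.1
    · exact (he k).2.2.2
  have hnot : ∀ (a : Fin 2) (k : Fin 3), (e k : V) ∉ (![C, N] a : Set V) := by
    intro a k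
    fin_cases a
    · exact (he k).1
    · exact (he k).2.1
  refine hG ⟨Sum.elim ![C, N] fun k => {(e k : V)}, ?_, ?_, ?_⟩
  · rintro (a | k)
    · fin_cases a
      · exact hC
      · exact hN
    · exact connected_singleton _
  · rintro (a | k) (a' | k') hne
    · fin_cases a <;> fin_cases a'
      · exact absurd rfl hne
      · exact hCN
      · exact hCN.symm
      · exact absurd rfl hne
    · exact Set.disjoint_singleton_right.2 (hnot a k')
    · exact Set.disjoint_singleton_left.2 (hnot a' k)
    · refine Set.disjoint_singleton.2 fun h => hne ?_
      rw [e.injective (Subtype.ext h)]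
  · rintro (a | k) (a' | k') hadj
    · simp at hadj
    · obtain ⟨x, hx, hadj'⟩ := hE a k'
      exact ⟨x, hx, _, rfl, hadj'.symm⟩
    · obtain ⟨x, hx, hadj'⟩ := hE a' k
      exact ⟨_, rfl, x, hx, hadj'⟩
    · simp at hadj

/-- The second connected set of `card_le_two_of_not_isMinor` may be enlarged separately for each of
the vertices counted, as long as the enlargements avoid the first set and the vertices counted. -/
lemma card_le_two_of_reaching (hG : ¬ IsMinor (completeBipartiteGraph (Fin 2) (Fin 3)) G)
    {C N : Set V} (hC : (G.induce C).Connected) (hN : (G.induce N).Connected) (F : Finset V)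
    (hFC : ∀ b ∈ F, b ∉ C ∧ ∃ c ∈ C, G.Adj b c) (hNF : Disjoint N (C ∪ F))
    (hF : ∀ b ∈ F, ∃ A : Set V, (G.induce A).Connected ∧ Disjoint A (C ∪ F) ∧
      (A ∩ N).Nonempty ∧ ∃ v ∈ A, G.Adj b v) :
    F.card ≤ 2 := by
  choose! A hA hAF hAN hv using hF
  obtain ⟨⟨u, hu⟩⟩ := hN.nonempty
  have hdisj : Disjoint (N ∪ ⋃ b ∈ F, A b) (C ∪ F) :=
    Set.disjoint_union_left.2 ⟨hNF, Set.disjoint_iUnion₂_left.2 hAF⟩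
  refine card_le_two_of_not_isMinor hG hC (N := N ∪ ⋃ b ∈ F, A b) ?_ ?_ F ?_
  · refine connected_of_patches u (.inl hu) ?_
    rintro v (hvN | hvA)
    · exact ⟨N, Set.subset_union_left, hN, hu, hvN⟩
    · obtain ⟨b, hb, hvb⟩ := Set.mem_iUnion₂.1 hvA
      refine ⟨N ∪ A b, Set.union_subset_union_right _ (Set.subset_iUnion₂_of_subset b hb subset_rfl),
        ?_, .inl hu, .inr hvb⟩
      rw [Set.union_comm]
      exact SimpleGraph.induce_union_connected (hA b hb).preconnected hN.preconnected (hAN b hb)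
  · exact (hdisj.mono_right Set.subset_union_left).symm
  · intro b hb
    obtain ⟨v, hvA, hbv⟩ := hv b hb
    exact ⟨(hFC b hb).1, fun h => Set.disjoint_left.1 hdisj h (.inr hb), (hFC b hb).2,
      v, .inr (Set.mem_iUnion₂.2 ⟨b, hb, hvA⟩), hbv⟩

end Bipartite

/-! ### Merging stars -/

section Stars

variable {V ι : Type*} {G : SimpleGraph V}

/-- The vertex `b` has a path to `Y` which after `b` avoids `X`; the rest of the path is recorded
as a connected set. -/
def Reaches (G : SimpleGraph V) (b : V) (X Y : Set V) : Prop :=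
  ∃ A : Set V, (G.induce A).Connected ∧ Disjoint A X ∧ (A ∩ Y).Nonempty ∧ ∃ v ∈ A, G.Adj b v

/-- The star with centre `C i` and set of leaves `P i`. -/
def star (C : ι → Set V) (P : ι → Finset V) (i : ι) : Set V :=
  C i ∪ P i

/-- Pairwise disjoint stars with centres `C i` and sets of leaves `P i`, for `i ∈ I`. A centre is a
connected set of vertices, to be thought of as contracted, and every leaf is adjacent to it. -/
structure IsStarFamily (G : SimpleGraph V) (I : Finset ι) (C : ι → Set V) (P : ι → Finset V) :
    Prop where
  connected : ∀ i ∈ I, (G.induce (C i)).Connected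
  adj : ∀ i ∈ I, ∀ p ∈ P i, ∃ c ∈ C i, G.Adj p c
  disjoint_leaves : ∀ i ∈ I, Disjoint (C i) (P i)
  disjoint : ∀ i ∈ I, ∀ j ∈ I, i ≠ j → Disjoint (star C P i) (star C P j)

variable {I : Finset ι} {C : ι → Set V} {P : ι → Finset V}

lemma IsStarFamily.connected_star (h : IsStarFamily G I C P) {i : ι} (hi : i ∈ I) :
    (G.induce (star C P i)).Connected :=
  connected_union_of_adj (h.connected i hi) (h.adj i hi)

open Classical in
/-- At most two leaves of a star reach a given connected set disjoint from the star. -/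
lemma IsStarFamily.card_filter_reaches_le
    (hG : ¬ IsMinor (completeBipartiteGraph (Fin 2) (Fin 3)) G)
    (h : IsStarFamily G I C P) {i : ι} (hi : i ∈ I) {N : Set V} (hN : (G.induce N).Connected)
    (hdisj : Disjoint N (star C P i)) :
    ((P i).filter fun b => Reaches G b (star C P i) N).card ≤ 2 := by
  have hsub : C i ∪ ((P i).filter fun b => Reaches G b (star C P i) N : Finset V) ⊆ star C P i :=
    Set.union_subset_union_right _ (Finset.coe_subset.2 (Finset.filter_subset _ _))
  refine card_le_two_of_reaching hG (h.connected i hi) hN _ ?_ (hdisj.mono_right hsub) ?_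
  · intro b hb
    have hb := (Finset.mem_filter.1 hb).1
    exact ⟨fun hbC => Set.disjoint_left.1 (h.disjoint_leaves i hi) hbC hb, h.adj i hi b hb⟩
  · intro b hb
    obtain ⟨A, hA, hAX, hAN, hv⟩ := (Finset.mem_filter.1 hb).2
    exact ⟨A, hA, hAX.mono_right hsub, hAN, hv⟩

/-- If every leaf of a star family reaches another star of the family, then there are at most four
leaves per star on average. Indeed two stars joined by a path outside all the stars can be merged
into one; the leaves of either star that reach the other star through this path are swallowed by the
new centre, and there are at most `2 + 2` of these. -/
theorem IsStarFamily.sum_card_le (hG : ¬ IsMinor (completeBipartiteGraph (Fin 2) (Fin 3)) G)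
    (h : IsStarFamily G I C P)
    (hreach : ∀ i ∈ I, ∀ p ∈ P i, ∃ j ∈ I, j ≠ i ∧ Reaches G p (star C P i) (star C P j)) :
    ∑ i ∈ I, (P i).card ≤ 4 * I.card := by
  classical
  induction hn : I.card generalizing I C P with
  | zero =>
    obtain rfl := Finset.card_eq_zero.1 hn
    simp
  | succ n ih =>
    by_cases hempty : ∀ i ∈ I, P i = ∅
    · rw [Finset.sum_eq_zero fun i hi => by rw [hempty i hi, Finset.card_empty]]
      exact Nat.zero_le _
    push Not at hempty
    obtain ⟨i, hi, p, hp⟩ := hempty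
    have hpi : p ∈ star C P i := .inr hp
    obtain ⟨j₀, hj₀, hj₀i, A, hA, hAX, ⟨a, haA, haj₀⟩, hv⟩ := hreach i hi p hp
    obtain ⟨T, hTA, u, huA, hT⟩ := exists_isConnector
      (U := ⋃ k ∈ I, ⋃ _ : k ≠ i, star C P k) hA
      ⟨a, haA, by simpa only [Set.mem_iUnion] using ⟨j₀, hj₀, hj₀i, haj₀⟩⟩ hv
    obtain ⟨j, hj, hji, huj⟩ : ∃ j, ∃ _ : j ∈ I, ∃ _ : j ≠ i, u ∈ star C P j := by
      simpa only [Set.mem_iUnion] using hT.mem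
    have hTstar : ∀ k ∈ I, Disjoint T (star C P k) := by
      intro k hk
      by_cases hki : k = i
      · subst hki
        exact hAX.mono_left hTA
      · refine hT.disjoint.mono_right fun x hx => ?_
        simpa only [Set.mem_iUnion] using ⟨k, hk, hki, hx⟩
    have hij : Disjoint (star C P i) (star C P j) := h.disjoint i hi j hj hji.symm
    have hNi : (G.induce (T ∪ star C P j)).Connected := by
      have := SimpleGraph.induce_union_connected hT.connected_end.preconnected
        (h.connected_star hj).preconnected ⟨u, .inl rfl, huj⟩
      rwa [Set.insert_union, Set.insert_eq_of_mem (.inr huj)] at this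
    have hNj : (G.induce (T ∪ star C P i)).Connected := by
      have := SimpleGraph.induce_union_connected hT.connected_start.preconnected
        (h.connected_star hi).preconnected ⟨p, .inl rfl, hpi⟩
      rwa [Set.insert_union, Set.insert_eq_of_mem (.inr hpi)] at this
    set Li := (P i).filter fun b => Reaches G b (star C P i) (T ∪ star C P j) with hLi
    set Lj := (P j).filter fun b => Reaches G b (star C P j) (T ∪ star C P i) with hLj
    have hLi2 : Li.card ≤ 2 := h.card_filter_reaches_le hG hi hNi
      (Set.disjoint_union_left.2 ⟨hTstar i hi, hij.symm⟩)
    have hLj2 : Lj.card ≤ 2 := h.card_filter_reaches_le hG hj hNj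
      (Set.disjoint_union_left.2 ⟨hTstar j hj, hij⟩)
    have hpLi : p ∈ Li := Finset.mem_filter.2 ⟨hp, insert u T, hT.connected_end,
      Set.disjoint_insert_left.2 ⟨Set.disjoint_right.1 hij huj, hTstar i hi⟩,
      ⟨u, .inl rfl, .inr huj⟩, hT.adj_start⟩
    have huLj : u ∈ C j ∪ (Lj : Set V) := by
      rcases huj with huC | huP
      · exact .inl huC
      · exact .inr <| Finset.mem_coe.2 <| Finset.mem_filter.2 ⟨huP, insert p T, hT.connected_start,
          Set.disjoint_insert_left.2 ⟨Set.disjoint_left.1 hij hpi, hTstar j hj⟩,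
          ⟨p, .inl rfl, .inr hpi⟩, hT.adj_end⟩
    have hLiP : Li ⊆ P i := Finset.filter_subset _ _
    have hLjP : Lj ⊆ P j := Finset.filter_subset _ _
    -- The merged star: the centre swallows both centres, the connecting path, and the leaves lost.
    set Cn : Set V := (C i ∪ Li) ∪ insert p (insert u T) ∪ (C j ∪ Lj) with hCn
    set Pn : Finset V := (P i \ Li) ∪ (P j \ Lj) with hPn
    have hCnconn : (G.induce Cn).Connected := by
      refine SimpleGraph.induce_union_connected (SimpleGraph.induce_union_connected
        (connected_union_of_adj (h.connected i hi) fun b hb =>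
          h.adj i hi b (hLiP hb)).preconnected hT.connected.preconnected
        ⟨p, .inr hpLi, .inl rfl⟩).preconnected
        (connected_union_of_adj (h.connected j hj) fun b hb =>
          h.adj j hj b (hLjP hb)).preconnected ⟨u, .inr (.inr (.inl rfl)), huLj⟩
    have hmem : ∀ x, x ∈ Cn ↔ (x ∈ C i ∨ x ∈ Li) ∨ x ∈ T ∨ (x ∈ C j ∨ x ∈ Lj) := by
      intro x
      constructor
      · rintro ((hx | rfl | rfl | hx) | hx)
        · exact .inl hx
        · exact .inl (.inr hpLi)
        · exact .inr (.inr huLj)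
        · exact .inr (.inl hx)
        · exact .inr (.inr hx)
      · rintro (hx | hx | hx)
        · exact .inl (.inl hx)
        · exact .inl (.inr (.inr (.inr hx)))
        · exact .inr hx
    have hstari : star (Function.update C i Cn) (Function.update P i Pn) i =
        star C P i ∪ (T ∪ star C P j) := by
      ext x
      simp only [star, Function.update_self, Set.mem_union, hmem, Finset.mem_coe, hPn,
        Finset.mem_union, Finset.mem_sdiff]
      have := @hLiP x
      have := @hLjP x
      tauto
    have hstar : ∀ k, k ≠ i → star (Function.update C i Cn) (Function.update P i Pn) k =
        star C P k := by
      intro k hk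
      simp only [star, Function.update_of_ne hk]
    have hnew : ∀ k ∈ I, k ≠ i → k ≠ j →
        Disjoint (star C P i ∪ (T ∪ star C P j)) (star C P k) := by
      intro k hk hki hkj
      exact Set.disjoint_union_left.2 ⟨h.disjoint i hi k hk hki.symm,
        Set.disjoint_union_left.2 ⟨hTstar k hk, h.disjoint j hj k hk hkj.symm⟩⟩
    have hfam : IsStarFamily G (I.erase j) (Function.update C i Cn) (Function.update P i Pn) := by
      refine ⟨?_, ?_, ?_, ?_⟩
      · intro k hk
        by_cases hki : k = i
        · subst hki
          rwa [Function.update_self]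
        · rw [Function.update_of_ne hki]
          exact h.connected k (Finset.mem_of_mem_erase hk)
      · intro k hk b hb
        by_cases hki : k = i
        · subst hki
          rw [Function.update_self] at hb ⊢
          rcases Finset.mem_union.1 hb with hb | hb
          · obtain ⟨c, hc, hbc⟩ := h.adj k hi b (Finset.mem_sdiff.1 hb).1
            exact ⟨c, (hmem c).2 (.inl (.inl hc)), hbc⟩
          · obtain ⟨c, hc, hbc⟩ := h.adj j hj b (Finset.mem_sdiff.1 hb).1
            exact ⟨c, (hmem c).2 (.inr (.inr (.inl hc))), hbc⟩
        · rw [Function.update_of_ne hki] at hb ⊢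
          exact h.adj k (Finset.mem_of_mem_erase hk) b hb
      · intro k hk
        by_cases hki : k = i
        · subst hki
          rw [Function.update_self, Function.update_self, Set.disjoint_right]
          intro b hb hbC
          have hCPk : b ∈ C k → b ∉ P k := fun hbC => Set.disjoint_left.1 (h.disjoint_leaves k hi) hbC
          have hCPj : b ∈ C j → b ∉ P j := fun hbC => Set.disjoint_left.1 (h.disjoint_leaves j hj) hbC
          rcases Finset.mem_union.1 hb with hb | hb <;> obtain ⟨hb, hbL⟩ := Finset.mem_sdiff.1 hb
          · have hbk : b ∈ star C P k := .inr hb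
            rcases (hmem b).1 hbC with (hb' | hb') | hb' | hb'
            · exact hCPk hb' hb
            · exact hbL hb'
            · exact Set.disjoint_left.1 (hTstar k hi) hb' hbk
            · exact Set.disjoint_left.1 hij hbk (hb'.imp_right fun hb' => hLjP hb')
          · have hbj : b ∈ star C P j := .inr hb
            rcases (hmem b).1 hbC with hb' | hb' | (hb' | hb')
            · exact Set.disjoint_left.1 hij (hb'.imp_right fun hb' => hLiP hb') hbj
            · exact Set.disjoint_left.1 (hTstar j hj) hb' hbj
            · exact hCPj hb' hb
            · exact hbL hb'
        · rw [Function.update_of_ne hki, Function.update_of_ne hki]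
          exact h.disjoint_leaves k (Finset.mem_of_mem_erase hk)
      · intro k hk l hl hkl
        obtain ⟨hkj, hkI⟩ := Finset.mem_erase.1 hk
        obtain ⟨hlj, hlI⟩ := Finset.mem_erase.1 hl
        by_cases hki : k = i
        · subst hki
          rw [hstari, hstar l hkl.symm]
          exact hnew l hlI hkl.symm hlj
        · rw [hstar k hki]
          by_cases hli : l = i
          · subst hli
            rw [hstari]
            exact (hnew k hkI hki hkj).symm
          · rw [hstar l hli]
            exact h.disjoint k hkI l hlI hkl
    have hreach' : ∀ k ∈ I.erase j, ∀ b ∈ Function.update P i Pn k, ∃ l ∈ I.erase j, l ≠ k ∧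
        Reaches G b (star (Function.update C i Cn) (Function.update P i Pn) k)
          (star (Function.update C i Cn) (Function.update P i Pn) l) := by
      intro k hk b hb
      obtain ⟨hkj, hkI⟩ := Finset.mem_erase.1 hk
      by_cases hki : k = i
      · subst hki
        rw [Function.update_self] at hb
        rw [hstari]
        rcases Finset.mem_union.1 hb with hb | hb <;> obtain ⟨hb, hbL⟩ := Finset.mem_sdiff.1 hb
        · obtain ⟨l, hl, hlk, B, hB, hBX, hBY, hbB⟩ := hreach k hi b hb
          have hBN : Disjoint B (T ∪ star C P j) := by
            by_contra hmeet
            exact hbL (Finset.mem_filter.2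
              ⟨hb, B, hB, hBX, Set.not_disjoint_iff_nonempty_inter.1 hmeet, hbB⟩)
          have hlj : l ≠ j := by
            rintro rfl
            exact Set.not_disjoint_iff_nonempty_inter.2 hBY
              (hBN.mono_right Set.subset_union_right)
          refine ⟨l, Finset.mem_erase.2 ⟨hlj, hl⟩, hlk, B, hB,
            Set.disjoint_union_right.2 ⟨hBX, hBN⟩, ?_, hbB⟩
          rwa [hstar l hlk]
        · obtain ⟨l, hl, hlj, B, hB, hBX, hBY, hbB⟩ := hreach j hj b hb
          have hBN : Disjoint B (T ∪ star C P k) := by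
            by_contra hmeet
            exact hbL (Finset.mem_filter.2
              ⟨hb, B, hB, hBX, Set.not_disjoint_iff_nonempty_inter.1 hmeet, hbB⟩)
          have hlk : l ≠ k := by
            rintro rfl
            exact Set.not_disjoint_iff_nonempty_inter.2 hBY
              (hBN.mono_right Set.subset_union_right)
          refine ⟨l, Finset.mem_erase.2 ⟨hlj, hl⟩, hlk, B, hB,
            Set.disjoint_union_right.2 ⟨hBN.mono_right Set.subset_union_right,
              Set.disjoint_union_right.2 ⟨hBN.mono_right Set.subset_union_left, hBX⟩⟩, ?_, hbB⟩
          rwa [hstar l hlk]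
      · rw [Function.update_of_ne hki] at hb
        rw [hstar k hki]
        obtain ⟨l, hl, hlk, B, hB, hBX, hBY, hbB⟩ := hreach k hkI b hb
        by_cases hl' : l = i ∨ l = j
        · refine ⟨i, Finset.mem_erase.2 ⟨hji.symm, hi⟩, fun h => hki h.symm, B, hB, hBX, ?_, hbB⟩
          rw [hstari]
          refine hBY.mono (Set.inter_subset_inter_right _ ?_)
          rcases hl' with rfl | rfl
          · exact Set.subset_union_left
          · exact Set.subset_union_right.trans Set.subset_union_right
        · push Not at hl'
          refine ⟨l, Finset.mem_erase.2 ⟨hl'.2, hl⟩, hlk, B, hB, hBX, ?_, hbB⟩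
          rwa [hstar l hl'.1]
    have hIH := ih hfam hreach' (by rw [Finset.card_erase_of_mem hj, hn]; rfl)
    have hi' : i ∈ I.erase j := Finset.mem_erase.2 ⟨hji.symm, hi⟩
    rw [← Finset.add_sum_erase _ _ hi', Function.update_self, Finset.sum_congr rfl
      (fun k hk => by rw [Function.update_of_ne (Finset.ne_of_mem_erase hk)] :
        ∀ k ∈ (I.erase j).erase i, (Function.update P i Pn k).card = (P k).card)] at hIH
    rw [← Finset.add_sum_erase _ _ hj, ← Finset.add_sum_erase _ _ hi']
    have hPdisj : Disjoint (P i \ Li) (P j \ Lj) := by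
      rw [Finset.disjoint_left]
      intro b hb hb'
      exact Set.disjoint_left.1 hij (.inr (Finset.mem_sdiff.1 hb).1)
        (.inr (Finset.mem_sdiff.1 hb').1)
    have hcard := Finset.card_union_of_disjoint hPdisj
    have h1 := Finset.card_sdiff_add_card_eq_card hLiP
    have h2 := Finset.card_sdiff_add_card_eq_card hLjP
    rw [← hPn] at hcard
    omega

end Stars

/-! ### Blocks and cells -/

section Domination

variable {V : Type*} [Fintype V] [DecidableEq V] (G : SimpleGraph V) [DecidableRel G.Adj]
  (S : Finset V)

/-- The vertices of `S` with a neighbour in `D_S(G)`. -/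
def lowDominators : Finset V :=
  {s ∈ S | ∃ d ∈ setD G S, G.Adj s d}

/-- The vertices of `S` without a neighbour in `D_S(G)`. -/
def highDominators : Finset V :=
  S \ lowDominators G S

/-- The vertices outside `D_S(G)` which neither are nor are dominated by a vertex of
`highDominators G S`; the vertices of `lowDominators G S` are kept in any case. -/
def remainder : Set V :=
  {v | v ∉ setD G S ∧ v ∉ highDominators G S ∧ (v ∈ S ∨ ∀ r ∈ highDominators G S, ¬ G.Adj v r)}

/-- The connected component of `v` in the graph induced on `remainder G S`, as a set of vertices
of `G`. It is empty if `v` is not in `remainder G S`. -/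
def cell (v : V) : Set V :=
  {w | ∃ A ⊆ remainder G S, (G.induce A).Connected ∧ v ∈ A ∧ w ∈ A}

/-- `a` assigns to every vertex outside `S` a neighbour in `S`, if possible one in
`highDominators G S`. -/
def IsAssignment (a : V → V) : Prop :=
  ∀ v ∉ S, a v ∈ S ∧ G.Adj v (a v) ∧
    ((∃ r ∈ highDominators G S, G.Adj v r) → a v ∈ highDominators G S)

/-- The vertex `r` together with the vertices outside `D_S(G)` and `S` assigned to it. -/
def block (a : V → V) (r : V) : Set V :=
  insert r {v | v ∉ S ∧ v ∉ setD G S ∧ a v = r}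

/-- The vertex `b` reaches the block of a vertex of `highDominators G S` other than its own. -/
def IsLinked (a : V → V) (b : V) : Prop :=
  ∃ r ∈ highDominators G S, r ≠ a b ∧ Reaches G b (block G S a (a b)) (block G S a r)

variable {G S} {a : V → V}

lemma mem_setB {v : V} : v ∈ setB G S ↔ 4 ≤ G.degree v ∧ v ∉ S := by
  simp [setB, highDegree]

lemma mem_setD {v : V} :
    v ∈ setD G S ↔ (G.degree v ≤ 3 ∧ ∀ w, G.Adj v w → G.degree w ≤ 3) ∧ v ∉ S := by
  simp [setD, lowDegree]

lemma not_adj_of_mem_setB_of_mem_setD {b d : V} (hb : b ∈ setB G S) (hd : d ∈ setD G S) :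
    ¬ G.Adj b d := fun h => by
  have h1 := (mem_setB.1 hb).1
  have h2 := (mem_setD.1 hd).1.2 b h.symm
  omega

lemma not_mem_setD_of_mem_setB {b : V} (hb : b ∈ setB G S) : b ∉ setD G S := fun hd => by
  have h1 := (mem_setB.1 hb).1
  have h2 := (mem_setD.1 hd).1.1
  omega

lemma highDominators_subset : highDominators G S ⊆ S := Finset.sdiff_subset

lemma lowDominators_subset : lowDominators G S ⊆ S := Finset.filter_subset _ _

lemma degree_le_of_mem_lowDominators {s : V} (hs : s ∈ lowDominators G S) : G.degree s ≤ 3 := by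
  obtain ⟨-, d, hd, hsd⟩ := Finset.mem_filter.1 hs
  exact (mem_setD.1 hd).1.2 s hsd.symm

lemma mem_lowDominators_or {s : V} (hs : s ∈ S) :
    s ∈ lowDominators G S ∨ s ∈ highDominators G S := by
  by_cases h : s ∈ lowDominators G S
  · exact .inl h
  · exact .inr (Finset.mem_sdiff.2 ⟨hs, h⟩)

lemma not_mem_highDominators {s : V} (hs : s ∈ lowDominators G S) : s ∉ highDominators G S :=
  fun h => (Finset.mem_sdiff.1 h).2 hs

lemma mem_remainder_of_mem_lowDominators {s : V} (hs : s ∈ lowDominators G S) :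
    s ∈ remainder G S :=
  ⟨fun h => (mem_setD.1 h).2 (lowDominators_subset hs), not_mem_highDominators hs,
    .inl (lowDominators_subset hs)⟩

lemma exists_isAssignment (hS : IsDominatingSet G S) : ∃ a, IsAssignment G S a := by
  have (v : V) : ∃ s, v ∉ S → s ∈ S ∧ G.Adj v s ∧
      ((∃ r ∈ highDominators G S, G.Adj v r) → s ∈ highDominators G S) := by
    by_cases hv : ∃ r ∈ highDominators G S, G.Adj v r
    · obtain ⟨r, hr, hvr⟩ := hv
      exact ⟨r, fun _ => ⟨highDominators_subset hr, hvr, fun _ => hr⟩⟩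
    · by_cases hvS : v ∈ S
      · exact ⟨v, fun h => absurd hvS h⟩
      · obtain ⟨s, hs, hvs⟩ := hS v hvS
        exact ⟨s, fun _ => ⟨hs, hvs, fun h => absurd h hv⟩⟩
  choose a ha using this
  exact ⟨a, ha⟩

lemma cell_subset (v : V) : cell G S v ⊆ remainder G S :=
  fun _ ⟨_, hA, _, _, hw⟩ => hA hw

lemma mem_cell_self {v : V} (hv : v ∈ remainder G S) : v ∈ cell G S v :=
  ⟨{v}, Set.singleton_subset_iff.2 hv, connected_singleton v, rfl, rfl⟩

lemma mem_cell_symm {v w : V} : w ∈ cell G S v → v ∈ cell G S w :=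
  fun ⟨A, hA, hconn, hv, hw⟩ => ⟨A, hA, hconn, hw, hv⟩

lemma mem_cell_trans {u v w : V} (hvu : v ∈ cell G S u) (hwv : w ∈ cell G S v) :
    w ∈ cell G S u := by
  obtain ⟨A, hA, hAc, hu, hv⟩ := hvu
  obtain ⟨B, hB, hBc, hv', hw⟩ := hwv
  exact ⟨A ∪ B, Set.union_subset hA hB,
    SimpleGraph.induce_union_connected hAc.preconnected hBc.preconnected ⟨v, hv, hv'⟩,
    .inl hu, .inr hw⟩

lemma cell_eq {v w : V} (h : w ∈ cell G S v) : cell G S w = cell G S v :=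
  Set.Subset.antisymm (fun _ hx => mem_cell_trans h hx)
    fun _ hx => mem_cell_trans (mem_cell_symm h) hx

lemma mem_cell_of_adj {u v w : V} (hv : v ∈ cell G S u) (hw : w ∈ remainder G S)
    (hvw : G.Adj v w) : w ∈ cell G S u :=
  mem_cell_trans hv ⟨{v, w}, Set.insert_subset (cell_subset u hv) (Set.singleton_subset_iff.2 hw),
    SimpleGraph.induce_pair_connected_of_adj hvw, .inl rfl, .inr rfl⟩

lemma connected_cell {v : V} (hv : v ∈ remainder G S) : (G.induce (cell G S v)).Connected := by
  refine connected_of_patches v (mem_cell_self hv) ?_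
  rintro w ⟨A, hA, hconn, hvA, hwA⟩
  exact ⟨A, fun x hx => ⟨A, hA, hconn, hvA, hx⟩, hconn, hvA, hwA⟩

lemma IsAssignment.mem_lowDominators (ha : IsAssignment G S a) {v : V} (hv : v ∉ S)
    (hav : a v ∉ highDominators G S) : a v ∈ lowDominators G S :=
  (mem_lowDominators_or (ha v hv).1).resolve_right hav

lemma IsAssignment.mem_remainder (ha : IsAssignment G S a) {v : V} (hv : v ∉ S)
    (hvD : v ∉ setD G S) (hav : a v ∉ highDominators G S) : v ∈ remainder G S :=
  ⟨hvD, fun h => hv (highDominators_subset h),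
    .inr fun r hr hvr => hav ((ha v hv).2.2 ⟨r, hr, hvr⟩)⟩

lemma IsAssignment.not_mem_highDominators (ha : IsAssignment G S a) {v : V} (hv : v ∉ S)
    (hvW : v ∈ remainder G S) : a v ∉ highDominators G S :=
  fun h => (hvW.2.2.resolve_left hv) _ h (ha v hv).2.1

lemma IsAssignment.assign_mem_lowDominators_of_mem_setD (ha : IsAssignment G S a) {d : V}
    (hd : d ∈ setD G S) : a d ∈ lowDominators G S := by
  have h := ha d (mem_setD.1 hd).2
  exact Finset.mem_filter.2 ⟨h.1, d, hd, h.2.1.symm⟩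

/-- The blocks and `remainder G S` cover the complement of `D_S(G)`. -/
lemma IsAssignment.mem_remainder_or_mem_block (ha : IsAssignment G S a) {v : V}
    (hv : v ∉ setD G S) :
    v ∈ remainder G S ∨ ∃ r ∈ highDominators G S, v ∈ block G S a r := by
  by_cases hvS : v ∈ S
  · rcases mem_lowDominators_or (G := G) hvS with h | h
    · exact .inl (mem_remainder_of_mem_lowDominators h)
    · exact .inr ⟨v, h, .inl rfl⟩
  · by_cases hav : a v ∈ highDominators G S
    · exact .inr ⟨a v, hav, .inr ⟨hvS, hv, rfl⟩⟩
    · exact .inl (ha.mem_remainder hvS hv hav)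

lemma IsAssignment.disjoint_remainder_block (ha : IsAssignment G S a) {r : V}
    (hr : r ∈ highDominators G S) : Disjoint (remainder G S) (block G S a r) := by
  rw [Set.disjoint_left]
  rintro v hvW (rfl | ⟨hvS, -, rfl⟩)
  · exact hvW.2.1 hr
  · exact ha.not_mem_highDominators hvS hvW hr

lemma disjoint_block {r r' : V} (hr : r ∈ highDominators G S) (hr' : r' ∈ highDominators G S)
    (hne : r ≠ r') : Disjoint (block G S a r) (block G S a r') := by
  rw [Set.disjoint_left]
  rintro v (rfl | ⟨hv, -, rfl⟩) (rfl | ⟨hv', -, h⟩)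
  · exact hne rfl
  · exact hv' (highDominators_subset hr)
  · exact hv (highDominators_subset hr')
  · exact hne h

open Classical in
/-- The vertices of `B_S(G)` which are dominated by `highDominators G S` and are linked. -/
lemma IsAssignment.card_linked_le (ha : IsAssignment G S a)
    (hG : ¬ IsMinor (completeBipartiteGraph (Fin 2) (Fin 3)) G) :
    ((setB G S).filter fun b => a b ∈ highDominators G S ∧ IsLinked G S a b).card ≤
      4 * (highDominators G S).card := by
  set E := (setB G S).filter fun b => a b ∈ highDominators G S ∧ IsLinked G S a b with hE
  let P : V → Finset V := fun r => E.filter fun b => a b = r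
  let C : V → Set V := fun r => block G S a r \ P r
  have hP : ∀ r b, b ∈ P r → b ∈ setB G S ∧ a b = r ∧ IsLinked G S a b := by
    intro r b hb
    have h := Finset.mem_filter.1 hb
    have hE := Finset.mem_filter.1 h.1
    exact ⟨hE.1, h.2, hE.2.2⟩
  have hPblock : ∀ r, (P r : Set V) ⊆ block G S a r := fun r b hb =>
    .inr ⟨(mem_setB.1 (hP r b hb).1).2, not_mem_setD_of_mem_setB (hP r b hb).1, (hP r b hb).2.1⟩
  have hstar : ∀ r, star C P r = block G S a r := fun r => Set.sdiff_union_of_subset (hPblock r)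
  have hrC : ∀ r ∈ highDominators G S, r ∈ C r := fun r hr =>
    ⟨.inl rfl, fun h => (mem_setB.1 (hP r r h).1).2 (highDominators_subset hr)⟩
  have hfam : IsStarFamily G (highDominators G S) C P := by
    refine ⟨?_, ?_, fun r _ => Set.disjoint_sdiff_left, ?_⟩
    · intro r hr
      refine connected_of_patches r (hrC r hr) ?_
      intro v hv
      rcases hv.1 with rfl | ⟨hvS, -, rfl⟩
      · exact ⟨{v}, Set.singleton_subset_iff.2 hv, connected_singleton v, rfl, rfl⟩
      · exact ⟨{v, a v}, Set.insert_subset hv (Set.singleton_subset_iff.2 (hrC _ hr)),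
          SimpleGraph.induce_pair_connected_of_adj (ha v hvS).2.1, .inr rfl, .inl rfl⟩
    · intro r hr b hb
      obtain ⟨hbB, rfl, -⟩ := hP r b hb
      exact ⟨a b, hrC _ hr, (ha b (mem_setB.1 hbB).2).2.1⟩
    · intro r hr r' hr' hne
      rw [hstar, hstar]
      exact disjoint_block hr hr' hne
  have h := hfam.sum_card_le hG (by
    intro r _ b hb
    obtain ⟨-, rfl, r', hr', hne, hreach⟩ := hP r b hb
    refine ⟨r', hr', hne, ?_⟩
    rwa [hstar, hstar])
  rwa [← Finset.card_eq_sum_card_fiberwise fun b hb => (Finset.mem_filter.1 hb).2.1] at h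

/-- A vertex of `B_S(G)` has a neighbour outside its own block, since it shares at most two
neighbours with the vertex it is assigned to. Unless it is linked, that neighbour is in the
remainder. -/
lemma IsAssignment.exists_adj_cell (ha : IsAssignment G S a)
    (hG : ¬ IsMinor (completeBipartiteGraph (Fin 2) (Fin 3)) G) {y : V} (hy : y ∈ setB G S)
    (hyl : ¬ IsLinked G S a y) :
    ∃ s ∈ lowDominators G S, ∃ z ∈ cell G S s, G.Adj y z := by
  have hyS := (mem_setB.1 hy).2
  have hadj := (ha y hyS).2.1
  have hcommon := card_le_two_of_not_isMinor hG (connected_singleton y)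
    (connected_singleton (a y)) (Set.disjoint_singleton.2 hadj.ne)
    (G.neighborFinset y ∩ G.neighborFinset (a y)) (by
      intro b hb
      simp only [Finset.mem_inter, SimpleGraph.mem_neighborFinset] at hb
      exact ⟨hb.1.ne', hb.2.ne', ⟨y, rfl, hb.1.symm⟩, a y, rfl, hb.2.symm⟩)
  obtain ⟨z, hz, hz'⟩ : ∃ z ∈ G.neighborFinset y,
      z ∉ insert (a y) (G.neighborFinset y ∩ G.neighborFinset (a y)) := by
    refine Finset.exists_mem_notMem_of_card_lt_card (lt_of_le_of_lt (Finset.card_insert_le _ _) ?_)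
    have := (mem_setB.1 hy).1
    rw [SimpleGraph.card_neighborFinset_eq_degree]
    omega
  have hyz : G.Adj y z := (SimpleGraph.mem_neighborFinset _ _ _).1 hz
  simp only [Finset.mem_insert, Finset.mem_inter, SimpleGraph.mem_neighborFinset, not_or, hyz,
    true_and] at hz'
  have hzD : z ∉ setD G S := fun h => not_adj_of_mem_setB_of_mem_setD hy h hyz
  have hzblock : z ∉ block G S a (a y) := by
    rintro (h | ⟨hzS, -, h⟩)
    · exact hz'.1 h
    · exact hz'.2 (h ▸ (ha z hzS).2.1.symm)
  rcases ha.mem_remainder_or_mem_block hzD with hzW | ⟨r, hr, hzr⟩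
  · by_cases hzS : z ∈ S
    · exact ⟨z, (mem_lowDominators_or hzS).resolve_right hzW.2.1, z, mem_cell_self hzW, hyz⟩
    · have hs := ha.mem_lowDominators hzS (ha.not_mem_highDominators hzS hzW)
      exact ⟨a z, hs, z, mem_cell_of_adj (mem_cell_self (mem_remainder_of_mem_lowDominators hs)) hzW
        (ha z hzS).2.1.symm, hyz⟩
  · refine absurd ⟨r, hr, ?_, {z}, connected_singleton z, Set.disjoint_singleton_left.2 hzblock,
      ⟨z, rfl, hzr⟩, z, rfl, hyz⟩ hyl
    rintro rfl
    exact hzblock hzr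

/-- A cell with an unlinked neighbour `y` has neighbours in no block but that of `y`. -/
lemma IsAssignment.mem_cell_or_mem_block (ha : IsAssignment G S a) {y s x v : V}
    (hay : a y ∈ highDominators G S) (hyl : ¬ IsLinked G S a y) (hs : s ∈ remainder G S)
    (hys : ∃ z ∈ cell G S s, G.Adj y z) (hx : x ∈ cell G S s) (hxv : G.Adj x v)
    (hv : v ∉ setD G S) : v ∈ cell G S s ∨ v ∈ block G S a (a y) := by
  rcases ha.mem_remainder_or_mem_block hv with hvW | ⟨r, hr, hvr⟩
  · exact .inl (mem_cell_of_adj hx hvW hxv)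
  · by_cases hra : r = a y
    · exact .inr (hra ▸ hvr)
    · obtain ⟨z, hz, hyz⟩ := hys
      exact absurd ⟨r, hr, hra, insert v (cell G S s),
        connected_insert (connected_cell hs) hx hxv.symm,
        Set.disjoint_insert_left.2 ⟨Set.disjoint_left.1 (disjoint_block hr hay hra) hvr,
          (ha.disjoint_remainder_block hay).mono_left (cell_subset s)⟩,
        ⟨v, .inl rfl, hvr⟩, z, .inr hz, hyz⟩ hyl

/-- At most two non-central vertices of a block have neighbours in a given cell. -/
lemma IsAssignment.card_block_adj_cell_le (ha : IsAssignment G S a)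
    (hG : ¬ IsMinor (completeBipartiteGraph (Fin 2) (Fin 3)) G) {r s : V}
    (hr : r ∈ highDominators G S) (hs : s ∈ remainder G S) (F : Finset V)
    (hF : ∀ v ∈ F, v ∈ block G S a r ∧ v ≠ r ∧ ∃ z ∈ cell G S s, G.Adj v z) : F.card ≤ 2 := by
  have hdisj := (ha.disjoint_remainder_block hr).mono_left (cell_subset s)
  refine card_le_two_of_not_isMinor hG (connected_singleton r) (connected_cell hs)
    (Set.disjoint_singleton_left.2 (Set.disjoint_right.1 hdisj (.inl rfl))) F ?_
  intro v hv
  obtain ⟨hvr, hne, hvz⟩ := hF v hv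
  refine ⟨hne, Set.disjoint_right.1 hdisj hvr, ?_, hvz⟩
  rcases hvr with h | ⟨hvS, -, rfl⟩
  · exact absurd h hne
  · exact ⟨a v, rfl, (ha v hvS).2.1⟩

/-- The extremal configuration at a cell is impossible: if `s` is the only vertex of `S` in its cell
and all neighbours of `s` are in `D_S(G)` or are vertices of `B_S(G)` dominated by
`lowDominators G S` only, then no unlinked vertex is adjacent to the cell. For then the cell
consists of `s` and at most two neighbours `b` of `s` (one neighbour of `s` is in
`D_S(G)`), and all neighbours of `b` lie in the cell or among two vertices of a single block. By the
degree condition there are two such `b`, and they share these two vertices and `s` as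
neighbours. -/
lemma IsAssignment.false_of_neighbors (ha : IsAssignment G S a)
    (hG : ¬ IsMinor (completeBipartiteGraph (Fin 2) (Fin 3)) G) {s y : V}
    (hs : s ∈ lowDominators G S)
    (huniq : ∀ s' ∈ lowDominators G S, s' ∈ cell G S s → s' = s)
    (hN : ∀ v, G.Adj s v → v ∈ setD G S ∨ v ∈ setB G S ∧ a v ∉ highDominators G S)
    (hy : y ∈ setB G S) (hay : a y ∈ highDominators G S) (hyl : ¬ IsLinked G S a y)
    (hys : ∃ z ∈ cell G S s, G.Adj y z) : False := by
  classical
  have hsW := mem_remainder_of_mem_lowDominators hs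
  set M : Finset V := {v ∈ G.neighborFinset s | v ∉ setD G S} with hM
  have hMB : ∀ b ∈ M, G.Adj s b ∧ b ∈ setB G S ∧ a b ∉ highDominators G S := by
    intro b hb
    obtain ⟨hsb, hbD⟩ := Finset.mem_filter.1 hb
    have hsb := (SimpleGraph.mem_neighborFinset _ _ _).1 hsb
    exact ⟨hsb, (hN b hsb).resolve_left hbD⟩
  have hMcard : M.card ≤ 2 := by
    obtain ⟨-, d, hd, hsd⟩ := Finset.mem_filter.1 hs
    have hlt : M.card < (G.neighborFinset s).card := Finset.card_lt_card <|
      Finset.filter_ssubset.2 ⟨d, (SimpleGraph.mem_neighborFinset _ _ _).2 hsd, not_not.2 hd⟩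
    rw [SimpleGraph.card_neighborFinset_eq_degree] at hlt
    have := degree_le_of_mem_lowDominators hs
    omega
  have hMcell : ∀ b ∈ M, b ∈ cell G S s := by
    intro b hb
    obtain ⟨hsb, hbB, hab⟩ := hMB b hb
    exact mem_cell_of_adj (mem_cell_self hsW) (ha.mem_remainder (mem_setB.1 hbB).2
      (not_mem_setD_of_mem_setB hbB) hab) hsb
  have hcell : ∀ w ∈ cell G S s, w = s ∨ w ∈ M := by
    intro w hw
    have hwW := cell_subset s hw
    by_cases hwS : w ∈ S
    · exact .inl (huniq w ((mem_lowDominators_or hwS).resolve_right hwW.2.1) hw)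
    · have hlow := ha.mem_lowDominators hwS (ha.not_mem_highDominators hwS hwW)
      have hws : a w = s := huniq _ hlow
        (mem_cell_of_adj hw (mem_remainder_of_mem_lowDominators hlow) (ha w hwS).2.1)
      refine .inr (Finset.mem_filter.2 ⟨(SimpleGraph.mem_neighborFinset _ _ _).2 ?_, hwW.1⟩)
      exact hws ▸ (ha w hwS).2.1.symm
  set F : Finset V :=
    {v | v ∈ block G S a (a y) ∧ v ≠ a y ∧ ∃ z ∈ cell G S s, G.Adj v z} with hF
  have hFcard : F.card ≤ 2 :=
    ha.card_block_adj_cell_le hG hay hsW F fun v hv => (Finset.mem_filter.1 hv).2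
  have hb : ∀ b ∈ M, F.card = 2 ∧ F ⊆ G.neighborFinset b ∧ (M.erase b).Nonempty := by
    intro b hbM
    obtain ⟨hsb, hbB, hab⟩ := hMB b hbM
    have hsub : G.neighborFinset b ⊆ F ∪ insert s (M.erase b) := by
      intro v hv
      have hbv := (SimpleGraph.mem_neighborFinset _ _ _).1 hv
      rcases ha.mem_cell_or_mem_block hay hyl hsW hys (hMcell b hbM) hbv
        (fun h => not_adj_of_mem_setB_of_mem_setD hbB h hbv) with hvc | hvb
      · rcases hcell v hvc with rfl | hvM
        · exact Finset.mem_union_right _ (Finset.mem_insert_self _ _)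
        · exact Finset.mem_union_right _
            (Finset.mem_insert_of_mem (Finset.mem_erase.2 ⟨hbv.ne', hvM⟩))
      · refine Finset.mem_union_left _ (Finset.mem_filter.2
          ⟨Finset.mem_univ _, hvb, ?_, b, hMcell b hbM, hbv.symm⟩)
        rintro rfl
        exact hab ((ha b (mem_setB.1 hbB).2).2.2 ⟨_, hay, hbv⟩)
    have h1 := (mem_setB.1 hbB).1
    rw [← SimpleGraph.card_neighborFinset_eq_degree] at h1
    have h2 := Finset.card_union_le F (insert s (M.erase b))
    have h3 := Finset.card_insert_le s (M.erase b)
    have h4 := Finset.card_erase_of_mem hbM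
    have h5 := Finset.card_le_card hsub
    have heq := Finset.eq_of_subset_of_card_le hsub (by omega)
    refine ⟨by omega, heq ▸ Finset.subset_union_left, Finset.card_pos.1 (by omega)⟩
  obtain ⟨b, hbM⟩ : M.Nonempty := by
    obtain ⟨z, hz, hyz⟩ := hys
    rcases hcell z hz with rfl | hzM
    · rcases hN y hyz.symm with h | h
      · exact absurd h (not_mem_setD_of_mem_setB hy)
      · exact absurd hay h.2
    · exact ⟨z, hzM⟩
  obtain ⟨hF2, hFb, c, hc⟩ := hb b hbM
  obtain ⟨hcb, hcM⟩ := Finset.mem_erase.1 hc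
  have hFc := (hb c hcM).2.1
  have hsF : s ∉ F := fun h => Set.disjoint_left.1 (ha.disjoint_remainder_block hay) hsW
    (Finset.mem_filter.1 h).2.1
  have h3 := card_le_two_of_not_isMinor hG (connected_singleton b) (connected_singleton c)
    (Set.disjoint_singleton.2 hcb.symm) (insert s F) (by
      intro v hv
      have hbv : G.Adj b v := by
        rcases Finset.mem_insert.1 hv with rfl | hv
        · exact (hMB b hbM).1.symm
        · exact (SimpleGraph.mem_neighborFinset _ _ _).1 (hFb hv)
      have hcv : G.Adj c v := by
        rcases Finset.mem_insert.1 hv with rfl | hv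
        · exact (hMB c hcM).1.symm
        · exact (SimpleGraph.mem_neighborFinset _ _ _).1 (hFc hv)
      exact ⟨hbv.ne', hcv.ne', ⟨b, rfl, hbv.symm⟩, c, rfl, hcv.symm⟩)
  rw [Finset.card_insert_of_notMem hsF, hF2] at h3
  omega

end Domination

/-! ### Counting -/

section Counting

variable {V : Type*} [Fintype V] [DecidableEq V] {G : SimpleGraph V} [DecidableRel G.Adj]
  {S : Finset V} {a : V → V}

open Classical in
/-- The count at a single cell. Here `N` stands for the vertices of `D_S(G)` and `B_S(G)` assigned to
vertices of `lowDominators G S` in the cell, and `U` for the unlinked vertices adjacent to the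
cell. -/
lemma IsAssignment.card_cell_le (ha : IsAssignment G S a)
    (hG : ¬ IsMinor (completeBipartiteGraph (Fin 2) (Fin 3)) G) {s : V}
    (hs : s ∈ lowDominators G S) (N U : Finset V)
    (hN : ∀ v ∈ N, (v ∈ setD G S ∨ v ∈ setB G S ∧ a v ∉ highDominators G S) ∧
      a v ∈ lowDominators G S ∧ a v ∈ cell G S s)
    (hU : ∀ y ∈ U, y ∈ setB G S ∧ a y ∈ highDominators G S ∧ ¬ IsLinked G S a y ∧
      ∃ z ∈ cell G S s, G.Adj y z) :
    N.card + U.card ≤ 4 * ((lowDominators G S).filter (· ∈ cell G S s)).card := by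
  set Ls := (lowDominators G S).filter (· ∈ cell G S s) with hLs
  have hsW := mem_remainder_of_mem_lowDominators hs
  have hNS : ∀ v ∈ N, v ∉ S := fun v hv =>
    (hN v hv).1.elim (fun h => (mem_setD.1 h).2) fun h => (mem_setB.1 h.1).2
  have hfib : ∀ s' ∈ Ls, N.filter (fun v => a v = s') ⊆ G.neighborFinset s' := by
    intro s' _ v hv
    obtain ⟨hvN, rfl⟩ := Finset.mem_filter.1 hv
    exact (SimpleGraph.mem_neighborFinset _ _ _).2 (ha v (hNS v hvN)).2.1.symm
  have hdeg : ∀ s' ∈ Ls, (G.neighborFinset s').card ≤ 3 := by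
    intro s' hs'
    rw [SimpleGraph.card_neighborFinset_eq_degree]
    exact degree_le_of_mem_lowDominators (Finset.mem_filter.1 hs').1
  have hNcard : N.card ≤ 3 * Ls.card :=
    Finset.card_le_mul_card_image_of_maps_to (f := a)
      (fun v hv => Finset.mem_filter.2 (hN v hv).2) 3
      fun s' hs' => (Finset.card_le_card (hfib s' hs')).trans (hdeg s' hs')
  have hUcard : U.card ≤ 2 := by
    rcases U.eq_empty_or_nonempty with rfl | ⟨y, hy⟩
    · simp
    obtain ⟨hyB, hay, hyl, hys⟩ := hU y hy
    refine ha.card_block_adj_cell_le hG hay hsW U fun v hv => ?_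
    obtain ⟨hvB, hav, hvl, z, hz, hvz⟩ := hU v hv
    have hvS := (mem_setB.1 hvB).2
    refine ⟨(ha.mem_cell_or_mem_block hay hyl hsW hys hz hvz.symm
      (not_mem_setD_of_mem_setB hvB)).resolve_left fun h =>
        ha.not_mem_highDominators hvS (cell_subset s h) hav, ?_, z, hz, hvz⟩
    rintro rfl
    exact hvS (highDominators_subset hay)
  have hsLs : s ∈ Ls := Finset.mem_filter.2 ⟨hs, mem_cell_self hsW⟩
  by_contra! hlt
  have hpos : 0 < Ls.card := Finset.card_pos.2 ⟨s, hsLs⟩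
  have hone : Ls.card = 1 := by omega
  obtain ⟨y, hy⟩ : U.Nonempty := Finset.card_pos.1 (by omega)
  have huniq : ∀ s' ∈ Ls, s' = s := fun s' hs' =>
    Finset.card_le_one.1 hone.le s' hs' s hsLs
  have hNs : N ⊆ G.neighborFinset s := by
    intro v hv
    have hav := huniq _ (Finset.mem_filter.2 (hN v hv).2)
    exact hfib s hsLs (Finset.mem_filter.2 ⟨hv, hav⟩)
  have hNeq := Finset.eq_of_subset_of_card_le hNs (by have := hdeg s hsLs; omega)
  obtain ⟨hyB, hay, hyl, hys⟩ := hU y hy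
  refine ha.false_of_neighbors hG hs
    (fun s' hs' hs'c => huniq s' (Finset.mem_filter.2 ⟨hs', hs'c⟩)) (fun v hv => ?_) hyB hay hyl hys
  exact (hN v (hNeq ▸ (SimpleGraph.mem_neighborFinset _ _ _).2 hv)).1

/-- All the vertices of `B_S(G)` and `D_S(G)` except the linked ones are paid for by
`lowDominators G S`, cell by cell. -/
lemma IsAssignment.card_add_card_le (ha : IsAssignment G S a)
    (hG : ¬ IsMinor (completeBipartiteGraph (Fin 2) (Fin 3)) G) (N U : Finset V)
    (hN : ∀ v ∈ N, (v ∈ setD G S ∨ v ∈ setB G S ∧ a v ∉ highDominators G S))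
    (hU : ∀ y ∈ U, y ∈ setB G S ∧ a y ∈ highDominators G S ∧ ¬ IsLinked G S a y) :
    N.card + U.card ≤ 4 * (lowDominators G S).card := by
  classical
  have haN : ∀ v ∈ N, a v ∈ lowDominators G S := by
    intro v hv
    rcases hN v hv with h | h
    · exact ha.assign_mem_lowDominators_of_mem_setD h
    · exact ha.mem_lowDominators (mem_setB.1 h.1).2 h.2
  have (y : V) : ∃ s, y ∈ U → s ∈ lowDominators G S ∧ ∃ z ∈ cell G S s, G.Adj y z := by
    by_cases hy : y ∈ U
    · obtain ⟨s, h⟩ := ha.exists_adj_cell hG (hU y hy).1 (hU y hy).2.2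
      exact ⟨s, fun _ => h⟩
    · exact ⟨y, fun h => absurd h hy⟩
  choose g hg using this
  set Q := (lowDominators G S).image (cell G S) with hQ
  rw [Finset.card_eq_sum_card_fiberwise (s := N) (t := Q) (f := fun v => cell G S (a v))
      fun v hv => Finset.mem_image_of_mem _ (haN v hv),
    Finset.card_eq_sum_card_fiberwise (s := U) (t := Q) (f := fun y => cell G S (g y))
      fun y hy => Finset.mem_image_of_mem _ (hg y hy).1,
    Finset.card_eq_sum_card_fiberwise (s := lowDominators G S) (t := Q) (f := cell G S)
      fun s hs => Finset.mem_image_of_mem _ hs,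
    ← Finset.sum_add_distrib, Finset.mul_sum]
  refine Finset.sum_le_sum fun q hq => ?_
  obtain ⟨s, hs, rfl⟩ := Finset.mem_image.1 hq
  have hiff : ∀ s' ∈ lowDominators G S, cell G S s' = cell G S s ↔ s' ∈ cell G S s :=
    fun s' hs' => ⟨fun h => h ▸ mem_cell_self (mem_remainder_of_mem_lowDominators hs'), cell_eq⟩
  rw [Finset.filter_congr hiff]
  refine ha.card_cell_le hG hs _ _ ?_ ?_
  · intro v hv
    obtain ⟨hv, hvs⟩ := Finset.mem_filter.1 hv
    exact ⟨hN v hv, haN v hv, (hiff _ (haN v hv)).1 hvs⟩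
  · intro y hy
    obtain ⟨hy, hys⟩ := Finset.mem_filter.1 hy
    obtain ⟨h1, h2, h3⟩ := hU y hy
    exact ⟨h1, h2, h3, hys ▸ (hg y hy).2⟩

/-- The bound of the theorem holds for all graphs without a `K_{2,3}` minor. -/
theorem card_setB_add_card_setD_le
    (hG : ¬ IsMinor (completeBipartiteGraph (Fin 2) (Fin 3)) G) (hS : IsDominatingSet G S) :
    (setB G S).card + (setD G S).card ≤ 4 * S.card := by
  classical
  obtain ⟨a, ha⟩ := exists_isAssignment hS
  have hlinked := ha.card_linked_le hG
  set B₁ := (setB G S).filter fun b => a b ∈ highDominators G S with hB₁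
  have hlow := ha.card_add_card_le hG
    (setD G S ∪ (setB G S).filter fun b => a b ∉ highDominators G S)
    (B₁.filter fun b => ¬ IsLinked G S a b)
    (fun v hv => (Finset.mem_union.1 hv).imp_right Finset.mem_filter.1)
    (fun y hy => by
      obtain ⟨hy, hl⟩ := Finset.mem_filter.1 hy
      obtain ⟨hyB, hay⟩ := Finset.mem_filter.1 hy
      exact ⟨hyB, hay, hl⟩)
  rw [Finset.card_union_of_disjoint (Finset.disjoint_left.2 fun v hD hB =>
    not_mem_setD_of_mem_setB (Finset.mem_filter.1 hB).1 hD)] at hlow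
  rw [← Finset.filter_filter, ← hB₁] at hlinked
  have h1 := Finset.card_filter_add_card_filter_not (s := setB G S)
    (fun b => a b ∈ highDominators G S)
  have h2 := Finset.card_filter_add_card_filter_not (s := B₁) (IsLinked G S a)
  have h3 := Finset.card_sdiff_add_card_eq_card (lowDominators_subset (G := G) (S := S))
  rw [← hB₁] at h1
  change (highDominators G S).card + _ = _ at h3
  omega

end Counting

end OuterplanarDomination

theorem lemma2p1 {V : Type*} [Fintype V] [DecidableEq V]
    (G : SimpleGraph V) [DecidableRel G.Adj] (S : Finset V)
    (hG : OuterplanarDomination.IsOuterplanar G)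
    (hS : OuterplanarDomination.IsDominatingSet G S) :
    (S.card : ℝ) ≥
      (1 / 4 : ℝ) * (((OuterplanarDomination.setB G S).card : ℝ) +
        ((OuterplanarDomination.setD G S).card : ℝ)) := by
  have h : (((OuterplanarDomination.setB G S).card : ℝ) +
      ((OuterplanarDomination.setD G S).card : ℝ)) ≤ 4 * (S.card : ℝ) := by
    exact_mod_cast OuterplanarDomination.card_setB_add_card_setD_le hG.2 hS
  linarith
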